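/- Let $\{H_n\}_{n\ge 1}$ be a positive linear recurrence sequence of length $L$ with coefficients $c_1,\dots,c_L$: the $H_n$ are positive integers, $L\ge 1$, $c_1,\dots,c_L$ are non-negative integers with $c_1,c_L>0$, $H_{n+1}=c_1H_n+\cdots+c_LH_{n+1-L}$ for $n\ge L$, $H_1=1$, and $H_{n+1}=c_1H_n+\cdots+c_nH_1+1$ for $1\le n<L$. Assume that its size $S=c_1+\cdots+c_L$ is at least $2$ (this excludes only the constant sequence $H_n=1$, where $L=c_1=1$ and the intervals $[H_n,H_{n+1})$ are empty). Call a finite sequence $(a_1,\dots,a_m)$ of non-negative integers admissible if either $m<L$ and $a_i=c_i$ for all $1\le i\le m$ (the empty sequence being admissible), or there is $s\in\{1,\dots,L\}$ with $s\le m$, $a_i=c_i$ for $i<s$, $a_s<c_s$, and $(a_{s+1},\dots,a_m)$ admissible. A decomposition $\sum_{i=1}^m a_iH_{m+1-i}$ of a positive integer is legal if $a_1>0$ and $(a_1,\dots,a_m)$ is admissible; its number of summands is $a_1+\cdots+a_m$. (Every positive integer has exactly one legal decomposition.) Let $\Omega_n$ be the finite set of legal decompositions of the integers in $[H_n,H_{n+1})$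 with the uniform probability measure, and let $K_n$ be the number of summands of a random element of $\Omega_n$. Then there is a constant $c>0$ such that $\mathrm{Var}[K_n]\ge c\,n$ for all $n>L$. Moreover there are real constants $C,d$ with $\mathrm{Var}[K_n]=Cn+d+o(1)$ as $n\to\infty$, and $C\ge c>0$. -/

import Mathlib

open scoped Topology ProbabilityTheory

/-- `H 1, H 2, …` is a positive linear recurrence sequence with length `L` and coefficients
`c 1, …, c L`. Sequences are indexed from `1`; the values `H 0`, `c 0` and `c i` for `i > L`
play no role. -/
structure IsPLRS (H : ℕ → ℕ) (L : ℕ) (c : ℕ → ℕ) : Prop where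
  length_pos : 0 < L
  coeff_one_pos : 0 < c 1
  coeff_last_pos : 0 < c L
  pos : ∀ n, 1 ≤ n → 0 < H n
  recurrence : ∀ n, L ≤ n → H (n + 1) = ∑ i ∈ Finset.Icc 1 L, c i * H (n + 1 - i)
  init_one : H 1 = 1
  init : ∀ n, 1 ≤ n → n < L → H (n + 1) = (∑ i ∈ Finset.Icc 1 n, c i * H (n + 1 - i)) + 1

/-- The size `c 1 + ⋯ + c L`. -/
def plrsSize (L : ℕ) (c : ℕ → ℕ) : ℕ := ∑ i ∈ Finset.Icc 1 L, c i

/-- The list `[c 1, …, c m]`. -/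
def coeffPrefix (c : ℕ → ℕ) (m : ℕ) : List ℕ := (List.range m).map fun i => c (i + 1)

/-- A coefficient list `[a₁, …, a_m]` satisfies Condition 1 or Condition 2 of legality. The
requirement `a₁ > 0` is not part of this predicate, since it concerns only the whole
decomposition: the tail left after a block may be empty or start with zeros. -/
inductive IsBlockLegal (L : ℕ) (c : ℕ → ℕ) : List ℕ → Prop
  /-- Condition 1: `m < L` and `aᵢ = cᵢ` for `1 ≤ i ≤ m` (a Type 1 block, or nothing if `m = 0`). -/
  | type1 (m : ℕ) (hm : m < L) : IsBlockLegal L c (coeffPrefix c m)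
  /-- Condition 2: the list begins with `c 1, …, c (s - 1), k` where `1 ≤ s ≤ L` and `k < c s`
  (a Type 2 block; here `s = j + 1`), and the remaining list `b` is again legal. -/
  | type2 (j k : ℕ) (b : List ℕ) (hj : j < L) (hk : k < c (j + 1)) (hb : IsBlockLegal L c b) :
      IsBlockLegal L c (coeffPrefix c j ++ k :: b)

/-- A coefficient list `[a₁, …, a_m]` is legal: `a₁ > 0` (in particular the list is nonempty)
and Condition 1 or Condition 2 holds. -/
def IsLegal (L : ℕ) (c : ℕ → ℕ) (a : List ℕ) : Prop :=
  0 < a.headD 0 ∧ IsBlockLegal L c a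

/-- The integer `a₁ H_m + a₂ H_{m-1} + ⋯ + a_m H_1` represented by `[a₁, …, a_m]`. -/
def decompValue (H : ℕ → ℕ) : List ℕ → ℕ
  | [] => 0
  | x :: b => x * H (b.length + 1) + decompValue H b

/-- The outcome space `Ω_n`: all legal decompositions of integers in `[H n, H (n + 1))`. -/
def legalDecomps (H : ℕ → ℕ) (L : ℕ) (c : ℕ → ℕ) (n : ℕ) : Set (List ℕ) :=
  {a | IsLegal L c a ∧ H n ≤ decompValue H a ∧ decompValue H a < H (n + 1)}

/-- Every set of coefficient lists is an event. -/
instance instMeasurableSpaceCoeffList : MeasurableSpace (List ℕ) := ⊤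

/-- The uniform probability measure on `Ω_n`. -/
noncomputable def plrsMeasure (H : ℕ → ℕ) (L : ℕ) (c : ℕ → ℕ) (n : ℕ) :
    MeasureTheory.Measure (List ℕ) :=
  ProbabilityTheory.uniformOn (legalDecomps H L c n)

/-- The number of summands `a₁ + ⋯ + a_m` of a decomposition, as a real random variable. -/
def numSummands (a : List ℕ) : ℝ := (a.sum : ℝ)

/-- The variance of the number of summands `K_n`. -/
noncomputable def varSummands (H : ℕ → ℕ) (L : ℕ) (c : ℕ → ℕ) (n : ℕ) : ℝ :=
  ProbabilityTheory.variance numSummands (plrsMeasure H L c n)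

/-!
An admissible list is a concatenation of blocks `c 1, …, c j, k` with `j < L` and `k < c (j + 1)`,
followed by a remainder shorter than `L`, and the outcomes in `Ω_n` are exactly the admissible
lists of length `n` with nonzero first entry (`IsPLRS.legalDecomps_eq`). Let `t ∈ (0, 1)` be the
solution of `∑ c_j t ^ j = 1`. Giving a block of length `ℓ` the probability `t ^ ℓ` turns the list
into a renewal process in which a block of length `ℓ` earns a reward, its digit sum `r`. With
`μ = 𝔼 r / 𝔼 ℓ` the centred reward `r - μ ℓ` has mean `0`, and the variance grows linearly with
slope `𝔼 (r - μ ℓ)² / 𝔼 ℓ`. The slope is positive: if it were `0`, then `r = μ ℓ` for every block;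
the block consisting of a single `0` would give `μ = 0`, whereas some block has a positive digit
sum because the size is at least `2`.

This is carried out with the sums of the powers `0`, `1`, `2` of the centred digit sum over all
admissible lists of length `m`, scaled by `t ^ m`. Splitting off the first block gives renewal
recurrences for them, each perturbed by the lower moments. `renewal_converges` shows, by
contraction of the oscillation over a window, that a solution with a geometrically decaying
perturbation converges geometrically fast. Hence the three sums are constant, constant and affine,
up to geometrically small errors (`IsPLRS.scaledMoment_asymptotics`), and the errors remain
negligible after multiplication by `n` when the variance is formed.

For the bound valid for every `n > L`, the asymptotics settle all large `n`; for the finitely many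
others it suffices that the variance is positive, which holds because two outcomes with different
numbers of summands exist (`IsPLRS.exists_numSummands_ne`).
-/

/-! ### Geometrically decaying sequences and the renewal recurrence -/

/-- The real sequence `e` is bounded by a geometric sequence of ratio less than `1`. -/
def GeomDecay (e : ℕ → ℝ) : Prop :=
  ∃ K ρ : ℝ, 0 ≤ K ∧ 0 < ρ ∧ ρ < 1 ∧ ∀ n, |e n| ≤ K * ρ ^ n

namespace GeomDecay

variable {e e' : ℕ → ℝ}

theorem zero : GeomDecay fun _ => 0 :=
  ⟨0, 1 / 2, le_rfl, by norm_num, by norm_num, by simp⟩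

theorem add (h : GeomDecay e) (h' : GeomDecay e') : GeomDecay fun n => e n + e' n := by
  obtain ⟨K, ρ, hK, hρ, hρ1, hb⟩ := h
  obtain ⟨K', ρ', hK', hρ', hρ1', hb'⟩ := h'
  refine ⟨K + K', max ρ ρ', by positivity, lt_max_of_lt_left hρ, max_lt hρ1 hρ1', fun n => ?_⟩
  have h1 : K * ρ ^ n ≤ K * max ρ ρ' ^ n := by gcongr; exact le_max_left _ _
  have h2 : K' * ρ' ^ n ≤ K' * max ρ ρ' ^ n := by gcongr; exact le_max_right _ _
  calc |e n + e' n| ≤ |e n| + |e' n| := abs_add_le _ _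
    _ ≤ (K + K') * max ρ ρ' ^ n := by linarith [hb n, hb' n]

theorem const_mul (h : GeomDecay e) (a : ℝ) : GeomDecay fun n => a * e n := by
  obtain ⟨K, ρ, hK, hρ, hρ1, hb⟩ := h
  refine ⟨|a| * K, ρ, by positivity, hρ, hρ1, fun n => ?_⟩
  rw [abs_mul, mul_assoc]
  exact mul_le_mul_of_nonneg_left (hb n) (abs_nonneg a)

theorem sum {ι : Type*} (s : Finset ι) {e : ι → ℕ → ℝ} (h : ∀ i ∈ s, GeomDecay (e i)) :
    GeomDecay fun n => ∑ i ∈ s, e i n := by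
  classical
  induction s using Finset.induction_on with
  | empty => simpa using zero
  | insert i s hi ih =>
    simp only [Finset.sum_insert hi]
    exact (h i (by simp)).add (ih fun j hj => h j (by simp [hj]))

theorem comp_sub (h : GeomDecay e) (k : ℕ) : GeomDecay fun n => e (n - k) := by
  obtain ⟨K, ρ, hK, hρ, hρ1, hb⟩ := h
  refine ⟨K / ρ ^ k, ρ, by positivity, hρ, hρ1, fun n => (hb _).trans ?_⟩
  rw [div_mul_eq_mul_div, le_div_iff₀ (by positivity), mul_assoc, ← pow_add]
  exact mul_le_mul_of_nonneg_left
    (pow_le_pow_of_le_one hρ.le hρ1.le (by omega)) hK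

theorem comp_succ (h : GeomDecay e) : GeomDecay fun n => e (n + 1) := by
  obtain ⟨K, ρ, hK, hρ, hρ1, hb⟩ := h
  refine ⟨K, ρ, hK, hρ, hρ1, fun n => (hb _).trans ?_⟩
  exact mul_le_mul_of_nonneg_left (pow_le_pow_of_le_one hρ.le hρ1.le (by omega)) hK

theorem tendsto_nat_mul (h : GeomDecay e) :
    Filter.Tendsto (fun n : ℕ => (n : ℝ) * e n) Filter.atTop (𝓝 0) := by
  obtain ⟨K, ρ, hK, hρ, hρ1, hb⟩ := h
  have h1 := (tendsto_self_mul_const_pow_of_lt_one hρ.le hρ1).const_mul K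
  rw [mul_zero] at h1
  refine squeeze_zero_norm (fun n => ?_) h1
  rw [Real.norm_eq_abs, abs_mul, Nat.abs_cast]
  calc (n : ℝ) * |e n| ≤ n * (K * ρ ^ n) := by gcongr; exact hb n
    _ = K * (n * ρ ^ n) := by ring

theorem tendsto (h : GeomDecay e) : Filter.Tendsto e Filter.atTop (𝓝 0) := by
  obtain ⟨K, ρ, hK, hρ, hρ1, hb⟩ := h
  have h1 := (tendsto_pow_atTop_nhds_zero_of_lt_one hρ.le hρ1).const_mul K
  rw [mul_zero] at h1
  exact squeeze_zero_norm hb h1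

end GeomDecay

/-- If a solution of the renewal recurrence is at most `h` on a window of length `L + 1`, then it
stays below `h` up to the accumulated perturbation, and the gap at the end of the window
persists, shrinking by at most the factor `p 0` in each step. -/
theorem renewal_gap {L m : ℕ} {p y g : ℕ → ℝ} {h G : ℝ} (hL : 0 < L)
    (hp : ∀ j, 0 ≤ p j) (hp1 : ∑ j ∈ Finset.range L, p j = 1)
    (hy : ∀ n, L ≤ n → y n = (∑ j ∈ Finset.range L, p j * y (n - 1 - j)) + g n)
    (hG : 0 ≤ G) (hg : ∀ n, m ≤ n → g n ≤ G) (hw : ∀ i, i ≤ L → y (m + i) ≤ h) (i : ℕ) :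
    p 0 ^ i * (h - y (m + L)) ≤ h + i * G - y (m + L + i) := by
  induction i using Nat.strong_induction_on with
  | _ i ih =>
  rcases i with _ | i
  · simp
  have hgap : 0 ≤ h - y (m + L) := sub_nonneg.2 (hw L le_rfl)
  have hle : ∀ j ∈ Finset.range L, 0 ≤ p j * (h + i * G - y (m + L + i - j)) := by
    intro j hj
    rw [Finset.mem_range] at hj
    refine mul_nonneg (hp j) ?_
    rcases Nat.lt_or_ge i j with hij | hij
    · have := hw (L + i - j) (by omega)
      rw [show m + L + i - j = m + (L + i - j) by omega]
      have : 0 ≤ (i : ℝ) * G := by positivity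
      linarith
    · have h1 := ih (i - j) (by omega)
      have h2 : 0 ≤ p 0 ^ (i - j) * (h - y (m + L)) := mul_nonneg (pow_nonneg (hp 0) _) hgap
      have h3 : ((i - j : ℕ) : ℝ) * G ≤ i * G := by
        gcongr
        omega
      rw [show m + L + i - j = m + L + (i - j) by omega]
      linarith
  have h0 := Finset.single_le_sum hle (Finset.mem_range.2 hL)
  have hsum : ∑ j ∈ Finset.range L, p j * (h + i * G - y (m + L + i - j)) =
      h + i * G - ∑ j ∈ Finset.range L, p j * y (m + L + i - j) := by
    simp only [mul_sub, Finset.sum_sub_distrib, ← Finset.sum_mul, hp1, one_mul]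
  have hrec := hy (m + L + (i + 1)) (by omega)
  have hgn := hg (m + L + (i + 1)) (by omega)
  rw [show m + L + (i + 1) - 1 = m + L + i by omega] at hrec
  have h1 := mul_le_mul_of_nonneg_left (ih i (by omega)) (hp 0)
  rw [hsum] at h0
  simp only [Nat.sub_zero] at h0
  push_cast
  rw [hrec, pow_succ']
  nlinarith

/-- The oscillation over windows of length `L + 1` contracts by a fixed factor after `L + 1`
steps, up to the perturbation. -/
theorem renewal_window {L m : ℕ} {p y g : ℕ → ℝ} {l D G : ℝ} (hL : 0 < L)
    (hp : ∀ j, 0 ≤ p j) (hp1 : ∑ j ∈ Finset.range L, p j = 1)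
    (hy : ∀ n, L ≤ n → y n = (∑ j ∈ Finset.range L, p j * y (n - 1 - j)) + g n)
    (hG : 0 ≤ G) (hg : ∀ n, m ≤ n → |g n| ≤ G)
    (hw : ∀ i, i ≤ L → y (m + i) ∈ Set.Icc l (l + D)) :
    ∃ l', ∀ i, i ≤ L → y (m + (L + 1) + i) ∈
      Set.Icc l' (l' + ((1 - p 0 ^ (L + 1)) * D + 2 * (L + 1) * G)) := by
  have hp01 : p 0 ≤ 1 := hp1 ▸ Finset.single_le_sum (fun j _ => hp j) (Finset.mem_range.2 hL)
  have hup := renewal_gap hL hp hp1 hy hG (fun n hn => (le_abs_self _).trans (hg n hn))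
    (fun i hi => (hw i hi).2)
  have hlo := renewal_gap (y := fun n => -y n) (g := fun n => -g n) (h := -l) hL hp hp1
    (fun n hn => by simp only [hy n hn, mul_neg, Finset.sum_neg_distrib]; ring) hG
    (fun n hn => (neg_le_abs _).trans (hg n hn)) (fun i hi => neg_le_neg (hw i hi).1)
  obtain ⟨hl, hh⟩ := hw L le_rfl
  refine ⟨l + p 0 ^ (L + 1) * (y (m + L) - l) - (L + 1) * G, fun i hi => ?_⟩
  have hq : p 0 ^ (L + 1) ≤ p 0 ^ (i + 1) := pow_le_pow_of_le_one (hp 0) hp01 (by omega)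
  have hGi : ((i + 1 : ℕ) : ℝ) * G ≤ (L + 1) * G := by
    gcongr
    exact_mod_cast Nat.succ_le_succ hi
  have h1 := hup (i + 1)
  have h2 := hlo (i + 1)
  have h3 := mul_le_mul_of_nonneg_right hq (sub_nonneg.2 hh)
  have h4 := mul_le_mul_of_nonneg_right hq (sub_nonneg.2 hl)
  rw [show m + L + (i + 1) = m + (L + 1) + i by omega] at h1 h2
  constructor <;> nlinarith

/-- A solution of an aperiodic (`0 < p 0`) renewal recurrence with geometrically decaying
perturbation converges geometrically fast. -/
theorem renewal_converges {L : ℕ} {p y g : ℕ → ℝ} (hL : 0 < L)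
    (hp : ∀ j, 0 ≤ p j) (hp0 : 0 < p 0) (hp1 : ∑ j ∈ Finset.range L, p j = 1)
    (hy : ∀ n, L ≤ n → y n = (∑ j ∈ Finset.range L, p j * y (n - 1 - j)) + g n)
    (hg : GeomDecay g) : ∃ Y, GeomDecay fun n => y n - Y := by
  obtain ⟨K, ρ, hK, hρ, hρ1, hb⟩ := hg
  have hp01 : p 0 ≤ 1 := hp1 ▸ Finset.single_le_sum (fun j _ => hp j) (Finset.mem_range.2 hL)
  set δ := p 0 ^ (L + 1) with hδ
  have hδ0 : 0 < δ := by positivity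
  have hδ1 : δ ≤ 1 := pow_le_one₀ hp0.le hp01
  -- Bernoulli's inequality: a ratio `s < 1` with `s ^ (L + 1) ≥ 1 - δ / 2`.
  obtain ⟨s, hρs, hs1, hs⟩ : ∃ s, ρ ≤ s ∧ s < 1 ∧ 1 - δ / 2 ≤ s ^ (L + 1) := by
    refine ⟨max ρ (1 - δ / 2 / (L + 1)), le_max_left _ _, max_lt hρ1 ?_, ?_⟩
    · have : 0 < δ / 2 / ((L : ℝ) + 1) := by positivity
      linarith
    · have hx : δ / 2 / ((L : ℝ) + 1) ≤ 1 :=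
        (div_le_self (by positivity) (by linarith [(Nat.cast_nonneg L : (0 : ℝ) ≤ L)])).trans
          (by linarith)
      have h1 := one_add_mul_le_pow (a := -(δ / 2 / ((L : ℝ) + 1))) (by linarith) (L + 1)
      have h2 : (1 - δ / 2 / ((L : ℝ) + 1)) ^ (L + 1) ≤
          max ρ (1 - δ / 2 / (L + 1)) ^ (L + 1) :=
        pow_le_pow_left₀ (by linarith) (le_max_right _ _) _
      refine le_trans (le_trans (le_of_eq ?_) h1) ?_
      · push_cast
        field_simp
        ring
      · rwa [← sub_eq_add_neg]
  have hs0 : 0 < s := hρ.trans_le hρs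
  obtain ⟨A, hA⟩ : ∃ A, ∀ i ≤ 2 * L + 1, |y i| ≤ A := by
    refine ⟨∑ i ∈ Finset.range (2 * L + 2), |y i|, fun i hi => ?_⟩
    exact Finset.single_le_sum (f := fun i => |y i|) (fun _ _ => abs_nonneg _)
      (Finset.mem_range.2 (by omega))
  have hA0 : 0 ≤ A := (abs_nonneg _).trans (hA 0 (by omega))
  set M := 2 * A / s ^ (L + 1) + 4 * (L + 1) * K / δ with hM
  have hM0 : 0 ≤ M := by positivity
  have key : ∀ m, ∃ l, ∀ i, i ≤ L → y (m + i) ∈ Set.Icc l (l + M * s ^ m) := by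
    intro m
    induction m using Nat.strong_induction_on with
    | _ m ih =>
    rcases Nat.lt_or_ge m (L + 1) with hm | hm
    · refine ⟨-A, fun i hi => ?_⟩
      have h1 := abs_le.1 (hA (m + i) (by omega))
      have h2 : 2 * A ≤ M * s ^ m := by
        calc 2 * A = 2 * A / s ^ (L + 1) * s ^ (L + 1) := by field_simp
          _ ≤ M * s ^ m := by
            refine mul_le_mul ?_ (pow_le_pow_of_le_one hs0.le hs1.le hm.le) (by positivity) hM0
            have : 0 ≤ 4 * (L + 1) * K / δ := by positivity
            linarith
      constructor <;> linarith
    · obtain ⟨k, rfl⟩ := Nat.exists_eq_add_of_le' hm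
      obtain ⟨l, hl⟩ := ih k (by omega)
      obtain ⟨l', hl'⟩ := renewal_window (G := K * s ^ k) hL hp hp1 hy (by positivity)
        (fun n hn => (hb n).trans (by
          calc K * ρ ^ n ≤ K * s ^ n := by gcongr
            _ ≤ K * s ^ k :=
              mul_le_mul_of_nonneg_left (pow_le_pow_of_le_one hs0.le hs1.le hn) hK)) hl
      refine ⟨l', fun i hi => ⟨(hl' i hi).1, (hl' i hi).2.trans ?_⟩⟩
      have h1 : 2 * (L + 1) * K ≤ M * (δ / 2) := by
        have : 0 ≤ 2 * A / s ^ (L + 1) * (δ / 2) := by positivity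
        have h2 : 4 * (L + 1) * K / δ * (δ / 2) = 2 * (L + 1) * K := by
          field_simp
          ring
        rw [hM, add_mul]
        linarith
      have hsk : 0 ≤ s ^ k := by positivity
      have h2 : M * (1 - δ / 2) ≤ M * s ^ (L + 1) := mul_le_mul_of_nonneg_left hs hM0
      have h3 := mul_le_mul_of_nonneg_right h1 hsk
      have h4 := mul_le_mul_of_nonneg_right h2 hsk
      rw [← hδ, pow_add s]
      linarith
  have hd : ∀ n, dist (y n) (y (n + 1)) ≤ M * s ^ n := by
    intro n
    obtain ⟨l, hl⟩ := key n
    have h1 := hl 0 (by omega)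
    have h2 := hl 1 (by omega)
    rw [Real.dist_eq, abs_le]
    rw [add_zero] at h1
    constructor <;> linarith [h1.1, h1.2, h2.1, h2.2]
  obtain ⟨Y, hY⟩ := cauchySeq_tendsto_of_complete (cauchySeq_of_le_geometric s M hs1 hd)
  refine ⟨Y, M / (1 - s), s, div_nonneg hM0 (by linarith), hs0, hs1, fun n => ?_⟩
  rw [← Real.dist_eq, div_mul_eq_mul_div]
  exact dist_le_of_le_geometric_of_tendsto s M hs1 hd hY n

/-- A nonnegative solution of the unperturbed renewal recurrence that is initially positive is
bounded below by a positive constant. -/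
theorem renewal_bounded_below {L : ℕ} {p y : ℕ → ℝ}
    (hp : ∀ j, 0 ≤ p j) (hp1 : ∑ j ∈ Finset.range L, p j = 1)
    (hy : ∀ n, L ≤ n → y n = ∑ j ∈ Finset.range L, p j * y (n - 1 - j))
    (hpos : ∀ n, 0 < y n) : ∃ ε, 0 < ε ∧ ∀ n, ε ≤ y n := by
  obtain ⟨i, -, hi⟩ := Finset.exists_min_image (Finset.range (L + 1)) y ⟨0, by simp⟩
  refine ⟨y i, hpos i, fun n => ?_⟩
  induction n using Nat.strong_induction_on with
  | _ n ih =>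
  rcases Nat.lt_or_ge n (L + 1) with hn | hn
  · exact hi n (Finset.mem_range.2 hn)
  · rw [hy n (by omega), ← one_mul (y i), ← hp1, Finset.sum_mul]
    exact Finset.sum_le_sum fun j _ => mul_le_mul_of_nonneg_left (ih _ (by omega)) (hp j)

/-! ### Variance under a uniform measure -/

theorem integral_uniformOn_finset {Ω : Type*} [MeasurableSpace Ω] [MeasurableSingletonClass Ω]
    (s : Finset Ω) (f : Ω → ℝ) :
    ∫ a, f a ∂(ProbabilityTheory.uniformOn (s : Set Ω)) = (∑ a ∈ s, f a) / s.card := by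
  have hi : MeasureTheory.IntegrableOn f s MeasureTheory.Measure.count := by
    rw [← Set.biUnion_of_singleton (s : Set Ω),
      MeasureTheory.integrableOn_finite_biUnion s.finite_toSet]
    exact fun x _ => MeasureTheory.integrableOn_singleton (by simp) (by simp)
  rw [ProbabilityTheory.uniformOn, ProbabilityTheory.cond, MeasureTheory.integral_smul_measure,
    MeasureTheory.setIntegral_finset _ hi, MeasureTheory.Measure.count_apply_finset]
  simp [MeasureTheory.measureReal_def, div_eq_inv_mul]

theorem variance_uniformOn_finset {Ω : Type*} [MeasurableSpace Ω] [MeasurableSingletonClass Ω]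
    (s : Finset Ω) {f : Ω → ℝ} (hf : Measurable f) :
    ProbabilityTheory.variance f (ProbabilityTheory.uniformOn (s : Set Ω)) =
      (∑ a ∈ s, (f a - (∑ b ∈ s, f b) / s.card) ^ 2) / s.card := by
  rw [ProbabilityTheory.variance_eq_integral hf.aemeasurable, integral_uniformOn_finset,
    integral_uniformOn_finset]

/-! ### Admissible coefficient lists -/

theorem coeffPrefix_succ (c : ℕ → ℕ) (j : ℕ) :
    coeffPrefix c (j + 1) = coeffPrefix c j ++ [c (j + 1)] := by
  simp [coeffPrefix, List.range_succ]

@[simp] theorem length_coeffPrefix (c : ℕ → ℕ) (j : ℕ) : (coeffPrefix c j).length = j := by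
  simp [coeffPrefix]

theorem coeffPrefix_succ_eq_cons (c : ℕ → ℕ) (j : ℕ) :
    ∃ l, coeffPrefix c (j + 1) = c 1 :: l := by
  simp [coeffPrefix, List.range_succ_eq_map]

theorem getElem?_block_of_lt {c : ℕ → ℕ} {i j k : ℕ} {b : List ℕ} (h : i < j) :
    (coeffPrefix c j ++ k :: b)[i]? = some (c (i + 1)) := by
  rw [List.getElem?_append_left (by simpa using h)]
  simp [coeffPrefix, h]

theorem getElem?_block_self {c : ℕ → ℕ} {j k : ℕ} {b : List ℕ} :
    (coeffPrefix c j ++ k :: b)[j]? = some k := by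
  rw [List.getElem?_append_right (by simp)]
  simp

/-- The first block of a list is determined by the first index at which the list differs from
the coefficient sequence. -/
theorem block_injective {c : ℕ → ℕ} {j j' k k' : ℕ} {b b' : List ℕ} (hk : k < c (j + 1))
    (hk' : k' < c (j' + 1)) (h : coeffPrefix c j ++ k :: b = coeffPrefix c j' ++ k' :: b') :
    j = j' ∧ k = k' ∧ b = b' := by
  have hj : j = j' := by
    rcases lt_trichotomy j j' with hlt | heq | hlt
    · have := getElem?_block_self (c := c) (j := j) (k := k) (b := b)
      rw [h, getElem?_block_of_lt hlt] at this
      simp only [Option.some.injEq] at this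
      omega
    · exact heq
    · have := getElem?_block_self (c := c) (j := j') (k := k') (b := b')
      rw [← h, getElem?_block_of_lt hlt] at this
      simp only [Option.some.injEq] at this
      omega
  subst hj
  have := List.append_cancel_left h
  simp only [List.cons.injEq] at this
  exact ⟨rfl, this⟩

theorem isBlockLegal_zero_cons_iff {L : ℕ} {c : ℕ → ℕ} (hL : 0 < L) (hc : 0 < c 1) {b : List ℕ} :
    IsBlockLegal L c (0 :: b) ↔ IsBlockLegal L c b := by
  constructor
  · intro h
    generalize ha : (0 :: b) = a at h
    cases h with
    | type1 m hm =>
      rcases m with _ | m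
      · simp [coeffPrefix] at ha
      · obtain ⟨l, hl⟩ := coeffPrefix_succ_eq_cons c m
        rw [hl, List.cons.injEq] at ha
        omega
    | type2 j k b' hj hk hb' =>
      rcases j with _ | j
      · simp only [coeffPrefix, List.range_zero, List.map_nil, List.nil_append,
          List.cons.injEq] at ha
        exact ha.2 ▸ hb'
      · obtain ⟨l, hl⟩ := coeffPrefix_succ_eq_cons c j
        rw [hl, List.cons_append, List.cons.injEq] at ha
        omega
  · intro h
    exact IsBlockLegal.type2 0 0 b hL hc h

theorem isBlockLegal_replicate_zero {L : ℕ} {c : ℕ → ℕ} (hL : 0 < L) (hc : 0 < c 1) (m : ℕ) :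
    IsBlockLegal L c (List.replicate m 0) := by
  induction m with
  | zero => exact IsBlockLegal.type1 0 hL
  | succ m ih => exact (isBlockLegal_zero_cons_iff hL hc).2 ih

theorem finite_isBlockLegal (L : ℕ) (c : ℕ → ℕ) (m : ℕ) :
    {a | IsBlockLegal L c a ∧ a.length = m}.Finite := by
  induction m using Nat.strong_induction_on with
  | _ m ih =>
  have hfin : (⋃ j ∈ Finset.range m, ⋃ k ∈ Finset.range (c (j + 1)),
      (fun b => coeffPrefix c j ++ k :: b) ''
        {a | IsBlockLegal L c a ∧ a.length = m - 1 - j}).Finite := by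
    refine Set.Finite.biUnion (Finset.finite_toSet _) fun j hj => ?_
    refine Set.Finite.biUnion (Finset.finite_toSet _) fun k _ => (ih _ ?_).image _
    have := Finset.mem_range.1 hj
    omega
  refine (hfin.insert (coeffPrefix c m)).subset ?_
  rintro a ⟨ha, hm⟩
  cases ha with
  | type1 m' hm' =>
    rw [length_coeffPrefix] at hm
    exact Or.inl (by rw [hm])
  | type2 j k b hj hk hb =>
    simp only [List.length_append, length_coeffPrefix, List.length_cons] at hm
    refine Or.inr ?_
    simp only [Set.mem_iUnion, Finset.mem_range]
    exact ⟨j, by omega, k, hk, b, ⟨hb, by omega⟩, rfl⟩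

/-- The finite set of lists of length `m` satisfying the block conditions; leading zeros are
allowed. -/
noncomputable def admissibleLists (L : ℕ) (c : ℕ → ℕ) (m : ℕ) : Finset (List ℕ) :=
  (finite_isBlockLegal L c m).toFinset

theorem mem_admissibleLists {L : ℕ} {c : ℕ → ℕ} {m : ℕ} {a : List ℕ} :
    a ∈ admissibleLists L c m ↔ IsBlockLegal L c a ∧ a.length = m := by
  simp [admissibleLists]

/-- Splitting off the first block. For `L ≤ m` no admissible list of length `m` is a mere prefix
of the coefficients, and every possible first block fits. -/
theorem sum_admissibleLists {L : ℕ} {c : ℕ → ℕ} {m : ℕ} (hm : L ≤ m) (F : List ℕ → ℝ) :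
    ∑ a ∈ admissibleLists L c m, F a =
      ∑ j ∈ Finset.range L, ∑ k ∈ Finset.range (c (j + 1)),
        ∑ b ∈ admissibleLists L c (m - 1 - j), F (coeffPrefix c j ++ k :: b) := by
  simp only [Finset.sum_sigma']
  symm
  refine Finset.sum_bij (fun x _ => coeffPrefix c x.1 ++ x.2.1 :: x.2.2) ?_ ?_ ?_ ?_
  · rintro ⟨j, k, b⟩ h
    simp only [Finset.mem_sigma, Finset.mem_range, mem_admissibleLists] at h ⊢
    refine ⟨IsBlockLegal.type2 j k b h.1 h.2.1 h.2.2.1, ?_⟩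
    simp only [List.length_append, length_coeffPrefix, List.length_cons, h.2.2.2]
    omega
  · rintro ⟨j, k, b⟩ h ⟨j', k', b'⟩ h' heq
    simp only [Finset.mem_sigma, Finset.mem_range] at h h'
    obtain ⟨rfl, rfl, rfl⟩ := block_injective h.2.1 h'.2.1 heq
    rfl
  · intro a ha
    obtain ⟨ha, hl⟩ := mem_admissibleLists.1 ha
    cases ha with
    | type1 m' hm' =>
      rw [length_coeffPrefix] at hl
      omega
    | type2 j k b hj hk hb =>
      simp only [List.length_append, length_coeffPrefix, List.length_cons] at hl
      refine ⟨⟨j, k, b⟩, ?_, rfl⟩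
      simp only [Finset.mem_sigma, Finset.mem_range, mem_admissibleLists]
      exact ⟨hj, hk, hb, by omega⟩
  · intros
    rfl

/-- The finite set of legal lists of length `m`. -/
noncomputable def legalLists (L : ℕ) (c : ℕ → ℕ) (m : ℕ) : Finset (List ℕ) :=
  (admissibleLists L c m).filter fun a => 0 < a.headD 0

theorem mem_legalLists {L : ℕ} {c : ℕ → ℕ} {m : ℕ} {a : List ℕ} :
    a ∈ legalLists L c m ↔ IsLegal L c a ∧ a.length = m := by
  simp [legalLists, mem_admissibleLists, IsLegal]
  tauto

/-- The admissible lists that are not legal are those with a leading zero. -/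
theorem sum_legalLists {L : ℕ} {c : ℕ → ℕ} (hL : 0 < L) (hc : 0 < c 1) (m : ℕ)
    (F : List ℕ → ℝ) :
    ∑ a ∈ legalLists L c (m + 1), F a =
      ∑ a ∈ admissibleLists L c (m + 1), F a - ∑ b ∈ admissibleLists L c m, F (0 :: b) := by
  rw [eq_sub_iff_add_eq, ← Finset.sum_filter_add_sum_filter_not (admissibleLists L c (m + 1))
    (fun a => 0 < a.headD 0) F]
  congr 1
  refine Finset.sum_bij (fun b _ => 0 :: b) ?_ ?_ ?_ ?_
  · intro b hb
    simpa [mem_admissibleLists, isBlockLegal_zero_cons_iff hL hc] using mem_admissibleLists.1 hb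
  · intro b _ b' _ h
    simpa using h
  · intro a ha
    simp only [Finset.mem_filter, mem_admissibleLists] at ha
    obtain ⟨⟨ha, hl⟩, h0⟩ := ha
    rcases a with _ | ⟨x, b⟩
    · simp at hl
    · simp only [List.headD_cons, not_lt, Nat.le_zero] at h0
      subst h0
      refine ⟨b, mem_admissibleLists.2 ⟨(isBlockLegal_zero_cons_iff hL hc).1 ha, ?_⟩, rfl⟩
      simpa using hl
  · intros
    rfl

/-! ### The outcome space -/

theorem sum_Icc_one_eq_sum_range (f : ℕ → ℕ) (r : ℕ) :
    ∑ i ∈ Finset.Icc 1 r, f i = ∑ i ∈ Finset.range r, f (i + 1) := by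
  rw [← Finset.Ico_add_one_right_eq_Icc, Finset.sum_Ico_eq_sum_range, Nat.add_sub_cancel]
  simp only [add_comm]

theorem headD_le_sum (a : List ℕ) : a.headD 0 ≤ a.sum := by
  cases a <;> simp

theorem decompValue_coeffPrefix_append (H c : ℕ → ℕ) (j : ℕ) (l : List ℕ) :
    decompValue H (coeffPrefix c j ++ l) =
      ∑ i ∈ Finset.range j, c (i + 1) * H (j + l.length - i) + decompValue H l := by
  induction j generalizing l with
  | zero => simp [coeffPrefix]
  | succ j ih =>
    rw [coeffPrefix_succ, List.append_assoc, List.singleton_append, ih, Finset.sum_range_succ,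
      decompValue, List.length_cons, show j + 1 + l.length - j = l.length + 1 by omega, add_assoc]
    congr 1
    refine Finset.sum_congr rfl fun i _ => ?_
    rw [show j + (l.length + 1) - i = j + 1 + l.length - i by omega]

namespace IsPLRS

variable {H : ℕ → ℕ} {L : ℕ} {c : ℕ → ℕ}

/-- A partial sum of the recurrence for `H (m + 1)`, also for `m < L`. -/
theorem sum_range_le (hH : IsPLRS H L c) {s m : ℕ} (hsL : s ≤ L) (hsm : s ≤ m) :
    ∑ i ∈ Finset.range s, c (i + 1) * H (m - i) ≤ H (m + 1) := by
  have hconv : ∀ r, ∑ i ∈ Finset.Icc 1 r, c i * H (m + 1 - i) =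
      ∑ i ∈ Finset.range r, c (i + 1) * H (m - i) := by
    intro r
    simp only [sum_Icc_one_eq_sum_range, Nat.add_sub_add_right]
  rcases Nat.lt_or_ge m L with hm | hm
  · rcases Nat.eq_zero_or_pos m with rfl | hm0
    · simp [Nat.le_zero.1 hsm]
    · rw [hH.init m hm0 hm, hconv]
      exact (Finset.sum_le_sum_of_subset (Finset.range_mono hsm)).trans (Nat.le_succ _)
  · rw [hH.recurrence m hm, hconv]
    exact Finset.sum_le_sum_of_subset (Finset.range_mono hsL)

theorem monotone_succ (hH : IsPLRS H L c) : Monotone fun n => H (n + 1) := by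
  refine monotone_nat_of_le_succ fun n => ?_
  have h := hH.sum_range_le (s := 1) (m := n + 1) hH.length_pos (by omega)
  simp only [Finset.sum_range_one, Nat.sub_zero, zero_add] at h
  exact (Nat.le_mul_of_pos_left _ hH.coeff_one_pos).trans h

/-- Replacing the digit `k` of the first block by `k + 1 ≤ c (j + 1)` absorbs the value of the
remaining list. -/
theorem decompValue_lt (hH : IsPLRS H L c) {a : List ℕ} (ha : IsBlockLegal L c a) :
    decompValue H a < H (a.length + 1) := by
  induction ha with
  | type1 m hm =>
    have h := decompValue_coeffPrefix_append H c m []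
    simp only [List.append_nil, List.length_nil, add_zero, decompValue] at h
    rw [h, length_coeffPrefix]
    rcases Nat.eq_zero_or_pos m with rfl | hm0
    · simpa using hH.pos 1 le_rfl
    · simp only [hH.init m hm0 hm, sum_Icc_one_eq_sum_range, Nat.add_sub_add_right]
      exact Nat.lt_succ_self _
  | type2 j k b hj hk hb ih =>
    have h := hH.sum_range_le (s := j + 1) (m := j + (b.length + 1)) hj (by omega)
    rw [Finset.sum_range_succ, show j + (b.length + 1) - j = b.length + 1 by omega] at h
    rw [decompValue_coeffPrefix_append, decompValue]
    simp only [List.length_append, length_coeffPrefix, List.length_cons]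
    have h1 : (k + 1) * H (b.length + 1) ≤ c (j + 1) * H (b.length + 1) :=
      Nat.mul_le_mul_right _ hk
    rw [add_mul, one_mul] at h1
    omega

/-- A legal list of length `m` has value in `[H m, H (m + 1))`, and these intervals are disjoint,
so the outcomes are the legal lists of length `n + 1`. -/
theorem legalDecomps_eq (hH : IsPLRS H L c) (n : ℕ) :
    legalDecomps H L c (n + 1) = legalLists L c (n + 1) := by
  ext a
  rw [Finset.mem_coe, mem_legalLists]
  have hlow : ∀ a : List ℕ, 0 < a.headD 0 →
      ∃ l, a.length = l + 1 ∧ H (l + 1) ≤ decompValue H a := by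
    rintro (_ | ⟨x, b⟩) hx
    · simp at hx
    · refine ⟨b.length, rfl, ?_⟩
      rw [decompValue]
      exact (Nat.le_mul_of_pos_left _ hx).trans (Nat.le_add_right _ _)
  constructor
  · rintro ⟨ha, h1, h2⟩
    refine ⟨ha, ?_⟩
    obtain ⟨l, hl, h3⟩ := hlow a ha.1
    have h4 := hH.decompValue_lt ha.2
    rw [hl] at h4 ⊢
    rcases lt_trichotomy l n with h | h | h
    · have : H (l + 1 + 1) ≤ H (n + 1) := hH.monotone_succ h
      omega
    · rw [h]
    · have : H (n + 1 + 1) ≤ H (l + 1) := hH.monotone_succ h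
      omega
  · rintro ⟨ha, hl⟩
    obtain ⟨l, hl', h3⟩ := hlow a ha.1
    have h4 := hH.decompValue_lt ha.2
    rw [hl] at h4
    obtain rfl : l = n := by omega
    exact ⟨ha, h3, h4⟩

/-- As the size is at least `2`, some block does not start with `0`. -/
theorem exists_block (hH : IsPLRS H L c) (hS : 2 ≤ plrsSize L c) :
    ∃ j k, j < L ∧ k < c (j + 1) ∧ ∀ b, 0 < (coeffPrefix c j ++ k :: b).headD 0 := by
  have hc := hH.coeff_one_pos
  have hL := hH.length_pos
  rcases Nat.lt_or_ge 1 (c 1) with h | h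
  · exact ⟨0, 1, hL, h, fun b => by simp [coeffPrefix]⟩
  · have hL1 : L ≠ 1 := by
      rintro rfl
      simp [plrsSize] at hS
      omega
    obtain ⟨j, rfl⟩ := Nat.exists_eq_add_of_le' (show 2 ≤ L by omega)
    refine ⟨j + 1, 0, by omega, hH.coeff_last_pos, fun b => ?_⟩
    obtain ⟨l, hl⟩ := coeffPrefix_succ_eq_cons c j
    rw [hl]
    exact hc

/-- Every positive length admits an admissible list with a nonzero digit. -/
theorem exists_sum_pos (hH : IsPLRS H L c) (hS : 2 ≤ plrsSize L c) (m : ℕ) :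
    ∃ a, IsBlockLegal L c a ∧ a.length = m + 1 ∧ 0 < a.sum := by
  rcases Nat.lt_or_ge (m + 1) L with hm | hm
  · refine ⟨_, IsBlockLegal.type1 (m + 1) hm, by simp, ?_⟩
    obtain ⟨l, hl⟩ := coeffPrefix_succ_eq_cons c m
    rw [hl, List.sum_cons]
    have := hH.coeff_one_pos
    omega
  · obtain ⟨j, k, hj, hk, hpos⟩ := hH.exists_block hS
    refine ⟨_, IsBlockLegal.type2 j k _ hj hk
      (isBlockLegal_replicate_zero hH.length_pos hH.coeff_one_pos (m - j)), ?_,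
      (hpos _).trans_le (headD_le_sum _)⟩
    simp only [List.length_append, length_coeffPrefix, List.length_cons, List.length_replicate]
    omega

/-- For `L < n` a block not starting with `0`, followed either by zeros only or by an admissible
list with positive sum, gives two outcomes with different numbers of summands. -/
theorem exists_numSummands_ne (hH : IsPLRS H L c) (hS : 2 ≤ plrsSize L c) {n : ℕ} (hn : L < n) :
    ∃ a ∈ legalLists L c n, ∃ a' ∈ legalLists L c n, numSummands a ≠ numSummands a' := by
  obtain ⟨j, k, hj, hk, hpos⟩ := hH.exists_block hS
  obtain ⟨m, hm⟩ : ∃ m, n = j + (m + 1 + 1) := ⟨n - j - 2, by omega⟩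
  obtain ⟨b, hb, hbl, hbs⟩ := hH.exists_sum_pos hS m
  refine ⟨coeffPrefix c j ++ k :: List.replicate (m + 1) 0, mem_legalLists.2 ⟨⟨hpos _, ?_⟩, ?_⟩,
    coeffPrefix c j ++ k :: b, mem_legalLists.2 ⟨⟨hpos _, ?_⟩, ?_⟩, ?_⟩
  · exact IsBlockLegal.type2 j k _ hj hk
      (isBlockLegal_replicate_zero hH.length_pos hH.coeff_one_pos _)
  · simp [hm]
  · exact IsBlockLegal.type2 j k _ hj hk hb
  · simp [hm, hbl]
  · rw [numSummands, numSummands, Ne, Nat.cast_inj, List.sum_append, List.sum_append,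
      List.sum_cons, List.sum_cons, List.sum_replicate, smul_zero]
    omega

theorem varSummands_eq (hH : IsPLRS H L c) (n : ℕ) :
    varSummands H L c (n + 1) =
      (∑ a ∈ legalLists L c (n + 1), (numSummands a -
        (∑ b ∈ legalLists L c (n + 1), numSummands b) / (legalLists L c (n + 1)).card) ^ 2) /
        (legalLists L c (n + 1)).card := by
  have : MeasurableSingletonClass (List ℕ) := ⟨fun _ => trivial⟩
  rw [varSummands, plrsMeasure, hH.legalDecomps_eq]
  exact variance_uniformOn_finset _ fun _ _ => trivial

theorem varSummands_pos (hH : IsPLRS H L c) (hS : 2 ≤ plrsSize L c) {n : ℕ} (hn : L < n) :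
    0 < varSummands H L c n := by
  obtain ⟨a, ha, a', ha', hne⟩ := hH.exists_numSummands_ne hS hn
  obtain ⟨m, rfl⟩ : ∃ m, n = m + 1 := ⟨n - 1, by omega⟩
  rw [hH.varSummands_eq]
  refine div_pos ?_ (by exact_mod_cast Finset.card_pos.2 ⟨a, ha⟩)
  refine lt_of_le_of_ne (Finset.sum_nonneg fun _ _ => sq_nonneg _) fun h => hne ?_
  have h0 := (Finset.sum_eq_zero_iff_of_nonneg fun _ _ => sq_nonneg _).1 h.symm
  have h1 := pow_eq_zero_iff (two_ne_zero) |>.1 (h0 a ha)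
  have h2 := pow_eq_zero_iff (two_ne_zero) |>.1 (h0 a' ha')
  linarith

end IsPLRS

/-! ### Centred moments of admissible lists -/

/-- The number of summands of a list, centred by `μ` per digit. -/
def centredSum (μ : ℝ) (a : List ℕ) : ℝ := a.sum - μ * a.length

/-- The `i`-th moment of `centredSum μ` over the admissible lists of length `m`, scaled by `t ^ m`
in place of the number of lists. -/
noncomputable def scaledMoment (L : ℕ) (c : ℕ → ℕ) (t μ : ℝ) (i m : ℕ) : ℝ :=
  t ^ m * ∑ a ∈ admissibleLists L c m, centredSum μ a ^ i

/-- The value of `centredSum μ` on the block `c 1, …, c j, k`. -/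
def blockCentredSum (c : ℕ → ℕ) (μ : ℝ) (j k : ℕ) : ℝ :=
  ((coeffPrefix c j).sum + k : ℕ) - μ * (j + 1)

theorem centredSum_block (c : ℕ → ℕ) (μ : ℝ) (j k : ℕ) (b : List ℕ) :
    centredSum μ (coeffPrefix c j ++ k :: b) = blockCentredSum c μ j k + centredSum μ b := by
  simp only [centredSum, blockCentredSum, List.sum_append, List.sum_cons, List.length_append,
    length_coeffPrefix, List.length_cons]
  push_cast
  ring

theorem scaledMoment_eq {L : ℕ} {c : ℕ → ℕ} {m : ℕ} (hm : L ≤ m) (t μ : ℝ) (i : ℕ) :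
    scaledMoment L c t μ i m =
      ∑ j ∈ Finset.range L, ∑ k ∈ Finset.range (c (j + 1)), t ^ (j + 1) *
        (t ^ (m - 1 - j) * ∑ b ∈ admissibleLists L c (m - 1 - j),
          (blockCentredSum c μ j k + centredSum μ b) ^ i) := by
  rw [scaledMoment, sum_admissibleLists hm, Finset.mul_sum]
  refine Finset.sum_congr rfl fun j hj => ?_
  rw [Finset.mul_sum]
  refine Finset.sum_congr rfl fun k _ => ?_
  have := Finset.mem_range.1 hj
  rw [← mul_assoc, ← pow_add, show j + 1 + (m - 1 - j) = m by omega]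
  simp only [centredSum_block]

theorem scaledMoment_zero_rec {L : ℕ} {c : ℕ → ℕ} {m : ℕ} (hm : L ≤ m) (t μ : ℝ) :
    scaledMoment L c t μ 0 m =
      ∑ j ∈ Finset.range L, c (j + 1) * t ^ (j + 1) * scaledMoment L c t μ 0 (m - 1 - j) := by
  rw [scaledMoment_eq hm]
  simp [scaledMoment, mul_assoc]

theorem scaledMoment_one_rec {L : ℕ} {c : ℕ → ℕ} {m : ℕ} (hm : L ≤ m) (t μ : ℝ) :
    scaledMoment L c t μ 1 m =
      (∑ j ∈ Finset.range L, c (j + 1) * t ^ (j + 1) * scaledMoment L c t μ 1 (m - 1 - j)) +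
      ∑ j ∈ Finset.range L, ∑ k ∈ Finset.range (c (j + 1)),
        t ^ (j + 1) * blockCentredSum c μ j k * scaledMoment L c t μ 0 (m - 1 - j) := by
  rw [scaledMoment_eq hm, ← Finset.sum_add_distrib]
  refine Finset.sum_congr rfl fun j _ => ?_
  have h : ∀ x : ℝ, c (j + 1) * t ^ (j + 1) * x =
      ∑ k ∈ Finset.range (c (j + 1)), t ^ (j + 1) * x := by simp [mul_assoc]
  rw [h, ← Finset.sum_add_distrib]
  refine Finset.sum_congr rfl fun k _ => ?_
  simp only [scaledMoment, pow_one, pow_zero, Finset.sum_add_distrib, Finset.sum_const,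
    nsmul_eq_mul]
  ring

theorem scaledMoment_two_rec {L : ℕ} {c : ℕ → ℕ} {m : ℕ} (hm : L ≤ m) (t μ : ℝ) :
    scaledMoment L c t μ 2 m =
      (∑ j ∈ Finset.range L, c (j + 1) * t ^ (j + 1) * scaledMoment L c t μ 2 (m - 1 - j)) +
      ∑ j ∈ Finset.range L, ∑ k ∈ Finset.range (c (j + 1)),
        (t ^ (j + 1) * (2 * blockCentredSum c μ j k) * scaledMoment L c t μ 1 (m - 1 - j) +
          t ^ (j + 1) * blockCentredSum c μ j k ^ 2 * scaledMoment L c t μ 0 (m - 1 - j)) := by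
  rw [scaledMoment_eq hm, ← Finset.sum_add_distrib]
  refine Finset.sum_congr rfl fun j _ => ?_
  have h : ∀ x : ℝ, c (j + 1) * t ^ (j + 1) * x =
      ∑ k ∈ Finset.range (c (j + 1)), t ^ (j + 1) * x := by simp [mul_assoc]
  rw [h, ← Finset.sum_add_distrib]
  refine Finset.sum_congr rfl fun k _ => ?_
  simp only [scaledMoment, pow_one, pow_zero, add_sq, Finset.sum_add_distrib, Finset.sum_const,
    nsmul_eq_mul, ← Finset.mul_sum]
  ring

/-- The reciprocal `t` of the dominant root of the characteristic polynomial of the recurrence. -/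
theorem exists_reciprocal_root {L : ℕ} {c : ℕ → ℕ} (hS : 2 ≤ plrsSize L c) :
    ∃ t : ℝ, 0 < t ∧ t < 1 ∧ ∑ j ∈ Finset.range L, (c (j + 1) : ℝ) * t ^ (j + 1) = 1 := by
  have hcont : Continuous fun t : ℝ => ∑ j ∈ Finset.range L, (c (j + 1) : ℝ) * t ^ (j + 1) := by
    fun_prop
  have h1 : (1 : ℝ) < ∑ j ∈ Finset.range L, (c (j + 1) : ℝ) * 1 ^ (j + 1) := by
    rw [plrsSize, sum_Icc_one_eq_sum_range] at hS
    simp only [one_pow, mul_one]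
    exact_mod_cast hS
  obtain ⟨t, ht, hsum⟩ := intermediate_value_Ioo (zero_le_one' ℝ) hcont.continuousOn
    (show (1 : ℝ) ∈ Set.Ioo _ _ from ⟨by simp, h1⟩)
  exact ⟨t, ht.1, ht.2, hsum⟩

namespace IsPLRS

variable {H : ℕ → ℕ} {L : ℕ} {c : ℕ → ℕ}

/-- The scaled moments of order `0`, `1`, `2` are, up to geometrically small errors, constant,
constant, and affine with positive slope. -/
theorem scaledMoment_asymptotics (hH : IsPLRS H L c) (hS : 2 ≤ plrsSize L c) :
    ∃ t μ U V α W : ℝ, 0 < t ∧ t < 1 ∧ 0 < U ∧ 0 < α ∧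
      GeomDecay (fun n => scaledMoment L c t μ 0 n - U) ∧
      GeomDecay (fun n => scaledMoment L c t μ 1 n - V) ∧
      GeomDecay (fun n => scaledMoment L c t μ 2 n - α * n - W) := by
  obtain ⟨t, ht0, ht1, hp1⟩ := exists_reciprocal_root hS
  have hL := hH.length_pos
  have hc := hH.coeff_one_pos
  set p : ℕ → ℝ := fun j => (c (j + 1) : ℝ) * t ^ (j + 1) with hpdef
  have hp : ∀ j, 0 ≤ p j := fun j => by positivity
  have hp0 : 0 < p 0 := by
    have : (0 : ℝ) < c 1 := by exact_mod_cast hc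
    simp only [hpdef, zero_add, pow_one]
    positivity
  -- `E` is the mean length and `R` the mean digit sum of a block when blocks of length `ℓ` have
  -- probability `t ^ ℓ`; for `μ = R / E` the centred digit sum of a block has mean `0`.
  set E : ℝ := ∑ j ∈ Finset.range L, p j * (j + 1) with hE
  have hE0 : 0 < E := by
    refine Finset.sum_pos' (fun j _ => mul_nonneg (hp j) (by positivity))
      ⟨0, Finset.mem_range.2 hL, ?_⟩
    simpa using hp0
  set R : ℝ := ∑ j ∈ Finset.range L, ∑ k ∈ Finset.range (c (j + 1)),
    t ^ (j + 1) * (((coeffPrefix c j).sum + k : ℕ) : ℝ) with hR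
  set μ := R / E with hμ
  have hmean : ∑ j ∈ Finset.range L, ∑ k ∈ Finset.range (c (j + 1)),
      t ^ (j + 1) * blockCentredSum c μ j k = 0 := by
    have h1 : ∑ j ∈ Finset.range L, ∑ k ∈ Finset.range (c (j + 1)),
        t ^ (j + 1) * blockCentredSum c μ j k = R - μ * E := by
      rw [hR, hE, Finset.mul_sum, ← Finset.sum_sub_distrib]
      refine Finset.sum_congr rfl fun j _ => ?_
      simp only [blockCentredSum, mul_sub, Finset.sum_sub_distrib, Finset.sum_const,
        Finset.card_range, nsmul_eq_mul, hpdef]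
      ring
    rw [h1, hμ]
    field_simp
    ring
  set v : ℝ := ∑ j ∈ Finset.range L, ∑ k ∈ Finset.range (c (j + 1)),
    t ^ (j + 1) * blockCentredSum c μ j k ^ 2 with hv
  have hterm : ∀ j k, 0 ≤ t ^ (j + 1) * blockCentredSum c μ j k ^ 2 := fun j k => by positivity
  have hv0 : 0 < v := by
    refine lt_of_le_of_ne
      (Finset.sum_nonneg fun j _ => Finset.sum_nonneg fun k _ => hterm j k) fun h => ?_
    have hzero : ∀ j k, j < L → k < c (j + 1) → blockCentredSum c μ j k = 0 := by
      intro j k hj hk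
      have h1 := (Finset.sum_eq_zero_iff_of_nonneg
        fun j _ => Finset.sum_nonneg fun k _ => hterm j k).1 h.symm j (Finset.mem_range.2 hj)
      have h2 := (Finset.sum_eq_zero_iff_of_nonneg
        fun k _ => hterm j k).1 h1 k (Finset.mem_range.2 hk)
      exact pow_eq_zero_iff two_ne_zero |>.1 ((mul_eq_zero.1 h2).resolve_left (by positivity))
    -- The block `0` forces `μ = 0`, which is incompatible with a block of positive digit sum.
    have hμ0 : μ = 0 := by
      have := hzero 0 0 hL hc
      simpa [blockCentredSum, coeffPrefix] using this
    obtain ⟨j, k, hj, hk, hpos⟩ := hH.exists_block hS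
    have h1 := hzero j k hj hk
    rw [blockCentredSum, hμ0, zero_mul, sub_zero, Nat.cast_eq_zero] at h1
    have h2 := (hpos []).trans_le (headD_le_sum _)
    rw [List.sum_append, List.sum_cons, List.sum_nil] at h2
    omega
  set u := scaledMoment L c t μ with hu
  have hu0pos : ∀ n, 0 < u 0 n := by
    intro n
    have : 0 < (admissibleLists L c n).card := Finset.card_pos.2
      ⟨_, mem_admissibleLists.2 ⟨isBlockLegal_replicate_zero hL hc n, by simp⟩⟩
    have h1 : (0 : ℝ) < (admissibleLists L c n).card := by exact_mod_cast this
    simp only [hu, scaledMoment, pow_zero, Finset.sum_const, nsmul_eq_mul, mul_one]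
    positivity
  have hrec0 : ∀ n, L ≤ n → u 0 n = ∑ j ∈ Finset.range L, p j * u 0 (n - 1 - j) :=
    fun n hn => scaledMoment_zero_rec hn t μ
  obtain ⟨U, hU⟩ := renewal_converges (y := u 0) hL hp hp0 hp1
    (fun n hn => by rw [hrec0 n hn, add_zero]) GeomDecay.zero
  have hU0 : 0 < U := by
    obtain ⟨ε, hε, hle⟩ := renewal_bounded_below hp hp1 hrec0 hu0pos
    have h1 := hU.tendsto.add_const U
    simp only [sub_add_cancel, zero_add] at h1
    exact hε.trans_le (ge_of_tendsto' h1 hle)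
  have hUs : ∀ j, GeomDecay fun n => u 0 (n - 1 - j) - U := fun j => by
    simpa only [Nat.sub_sub] using hU.comp_sub (1 + j)
  obtain ⟨V, hV⟩ := renewal_converges hL hp hp0 hp1
    (fun n hn => scaledMoment_one_rec hn t μ) (by
      have h1 : GeomDecay fun n => ∑ j ∈ Finset.range L, ∑ k ∈ Finset.range (c (j + 1)),
          t ^ (j + 1) * blockCentredSum c μ j k * (u 0 (n - 1 - j) - U) :=
        GeomDecay.sum _ fun j _ => GeomDecay.sum _ fun k _ => (hUs j).const_mul _
      convert h1 using 2 with n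
      simp only [mul_sub, Finset.sum_sub_distrib, ← Finset.sum_mul]
      rw [hmean, zero_mul, sub_zero])
  have hVs : ∀ j, GeomDecay fun n => u 1 (n - 1 - j) - V := fun j => by
    simpa only [Nat.sub_sub] using hV.comp_sub (1 + j)
  have hg : GeomDecay fun n => ∑ j ∈ Finset.range L, ∑ k ∈ Finset.range (c (j + 1)),
      (t ^ (j + 1) * (2 * blockCentredSum c μ j k) * (u 1 (n - 1 - j) - V) +
        t ^ (j + 1) * blockCentredSum c μ j k ^ 2 * (u 0 (n - 1 - j) - U)) :=
    GeomDecay.sum _ fun j _ => GeomDecay.sum _ fun k _ =>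
      ((hVs j).const_mul _).add ((hUs j).const_mul _)
  -- The perturbation of the second moment tends to `v * U`; subtracting the linear solution of
  -- slope `v * U / E` leaves a decaying perturbation.
  set α := v * U / E with hα
  obtain ⟨W, hW⟩ := renewal_converges (y := fun n => u 2 n - α * n) hL hp hp0 hp1 (by
    intro n hn
    have hlin : ∑ j ∈ Finset.range L, p j * (α * ((n - 1 - j : ℕ) : ℝ)) = α * n - v * U := by
      have h1 : ∀ j ∈ Finset.range L, p j * (α * ((n - 1 - j : ℕ) : ℝ)) =
          p j * (α * n) - α * (p j * (j + 1)) := by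
        intro j hj
        have h2 := Finset.mem_range.1 hj
        rw [Nat.sub_sub, Nat.cast_sub (by omega)]
        push_cast
        ring
      rw [Finset.sum_congr rfl h1, Finset.sum_sub_distrib, ← Finset.sum_mul, hp1,
        ← Finset.mul_sum, ← hE, hα]
      field_simp
    have hpert : ∑ j ∈ Finset.range L, ∑ k ∈ Finset.range (c (j + 1)),
        (t ^ (j + 1) * (2 * blockCentredSum c μ j k) * (u 1 (n - 1 - j) - V) +
          t ^ (j + 1) * blockCentredSum c μ j k ^ 2 * (u 0 (n - 1 - j) - U)) =
        ∑ j ∈ Finset.range L, ∑ k ∈ Finset.range (c (j + 1)),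
        (t ^ (j + 1) * (2 * blockCentredSum c μ j k) * u 1 (n - 1 - j) +
          t ^ (j + 1) * blockCentredSum c μ j k ^ 2 * u 0 (n - 1 - j)) - v * U := by
      have h1 : ∑ j ∈ Finset.range L, ∑ k ∈ Finset.range (c (j + 1)),
          t ^ (j + 1) * (2 * blockCentredSum c μ j k) = 0 := by
        have h3 := congrArg (2 * ·) hmean
        simp only [mul_zero, Finset.mul_sum] at h3
        rw [← h3]
        exact Finset.sum_congr rfl fun j _ => Finset.sum_congr rfl fun k _ => by ring
      simp only [mul_sub, Finset.sum_add_distrib, Finset.sum_sub_distrib, ← Finset.sum_mul]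
      rw [h1, ← hv]
      ring
    have h2 : u 2 n = (∑ j ∈ Finset.range L, p j * u 2 (n - 1 - j)) +
        ∑ j ∈ Finset.range L, ∑ k ∈ Finset.range (c (j + 1)),
        (t ^ (j + 1) * (2 * blockCentredSum c μ j k) * u 1 (n - 1 - j) +
          t ^ (j + 1) * blockCentredSum c μ j k ^ 2 * u 0 (n - 1 - j)) :=
      scaledMoment_two_rec hn t μ
    simp only [mul_sub (p _), Finset.sum_sub_distrib]
    rw [hpert, h2, hlin]
    ring) hg
  exact ⟨t, μ, U, V, α, W, ht0, ht1, hU0, by positivity, hU, hV, hW⟩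

end IsPLRS

/-! ### Variance of the number of summands -/

theorem sum_sq_sub_mean_div {ι : Type*} (s : Finset ι) (hs : s.Nonempty) (f : ι → ℝ) :
    (∑ a ∈ s, (f a - (∑ b ∈ s, f b) / s.card) ^ 2) / s.card =
      (∑ a ∈ s, f a ^ 2) / s.card - ((∑ a ∈ s, f a) / s.card) ^ 2 := by
  have : (s.card : ℝ) ≠ 0 := by exact_mod_cast hs.card_pos.ne'
  simp only [sub_sq, Finset.sum_add_distrib, Finset.sum_sub_distrib, ← Finset.sum_mul,
    ← Finset.mul_sum, Finset.sum_const, nsmul_eq_mul]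
  field_simp
  ring

namespace IsPLRS

variable {H : ℕ → ℕ} {L : ℕ} {c : ℕ → ℕ}

/-- The variance in terms of moments of `centredSum μ`, which on lists of a fixed length differs
from the number of summands by a constant. The scaling factor cancels. -/
theorem varSummands_eq_moments (hH : IsPLRS H L c) (hS : 2 ≤ plrsSize L c) {n : ℕ} (hn : L ≤ n)
    {t : ℝ} (ht : t ≠ 0) (μ : ℝ) :
    varSummands H L c (n + 1) =
      (t ^ (n + 1) * ∑ a ∈ legalLists L c (n + 1), centredSum μ a ^ 2) /
          (t ^ (n + 1) * ∑ a ∈ legalLists L c (n + 1), centredSum μ a ^ 0) -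
        ((t ^ (n + 1) * ∑ a ∈ legalLists L c (n + 1), centredSum μ a ^ 1) /
          (t ^ (n + 1) * ∑ a ∈ legalLists L c (n + 1), centredSum μ a ^ 0)) ^ 2 := by
  obtain ⟨a₀, ha₀, -⟩ := hH.exists_numSummands_ne hS (Nat.lt_succ_of_le hn)
  have hne : (legalLists L c (n + 1)).Nonempty := ⟨a₀, ha₀⟩
  have hcard : ((legalLists L c (n + 1)).card : ℝ) ≠ 0 := by exact_mod_cast hne.card_pos.ne'
  have hK : ∀ a ∈ legalLists L c (n + 1), numSummands a = centredSum μ a + μ * (n + 1 : ℕ) := by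
    intro a ha
    rw [centredSum, (mem_legalLists.1 ha).2, numSummands, sub_add_cancel]
  rw [mul_div_mul_left _ _ (pow_ne_zero _ ht), mul_div_mul_left _ _ (pow_ne_zero _ ht)]
  simp only [pow_zero, pow_one, Finset.sum_const, nsmul_eq_mul, mul_one]
  rw [hH.varSummands_eq, ← sum_sq_sub_mean_div _ hne, Finset.sum_congr rfl hK]
  congr 1
  refine Finset.sum_congr rfl fun a ha => ?_
  rw [hK a ha, Finset.sum_add_distrib, Finset.sum_const, nsmul_eq_mul, add_div,
    mul_div_cancel_left₀ _ hcard]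
  ring

/-- The moments of legal lists are differences of moments of admissible lists, since the centred
sum of `0 :: b` is that of `b` minus `μ`. -/
theorem scaled_sum_legalLists (hH : IsPLRS H L c) (t μ : ℝ) (n : ℕ) :
    (t ^ (n + 1) * ∑ a ∈ legalLists L c (n + 1), centredSum μ a ^ 0 =
      scaledMoment L c t μ 0 (n + 1) - t * scaledMoment L c t μ 0 n) ∧
    (t ^ (n + 1) * ∑ a ∈ legalLists L c (n + 1), centredSum μ a ^ 1 =
      scaledMoment L c t μ 1 (n + 1) - t * scaledMoment L c t μ 1 n +
        t * μ * scaledMoment L c t μ 0 n) ∧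
    (t ^ (n + 1) * ∑ a ∈ legalLists L c (n + 1), centredSum μ a ^ 2 =
      scaledMoment L c t μ 2 (n + 1) - t * scaledMoment L c t μ 2 n +
        2 * t * μ * scaledMoment L c t μ 1 n - t * μ ^ 2 * scaledMoment L c t μ 0 n) := by
  have h0 : ∀ b, centredSum μ (0 :: b) = centredSum μ b - μ := by
    intro b
    simp only [centredSum, List.sum_cons, List.length_cons]
    push_cast
    ring
  simp only [sum_legalLists hH.length_pos hH.coeff_one_pos, h0, scaledMoment, pow_zero, pow_one,
    sub_sq, Finset.sum_add_distrib, Finset.sum_sub_distrib, ← Finset.sum_mul, ← Finset.mul_sum,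
    Finset.sum_const, nsmul_eq_mul]
  refine ⟨?_, ?_, ?_⟩ <;> ring

theorem varSummands_asymptotics (hH : IsPLRS H L c) (hS : 2 ≤ plrsSize L c) :
    ∃ C d : ℝ, 0 < C ∧ Filter.Tendsto (fun n : ℕ => varSummands H L c n - (C * (n : ℝ) + d))
      Filter.atTop (𝓝 0) := by
  obtain ⟨t, μ, U, V, α, W, ht0, ht1, hU, hα, h0, h1, h2⟩ := hH.scaledMoment_asymptotics hS
  set B₀ := U * (1 - t) with hB₀
  set B₁ := V * (1 - t) + t * μ * U with hB₁
  set B₂ := α + W * (1 - t) + 2 * t * μ * V - t * μ ^ 2 * U with hB₂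
  set b : ℕ → ℕ → ℝ := fun i n =>
    t ^ (n + 1) * ∑ a ∈ legalLists L c (n + 1), centredSum μ a ^ i
  have hB₀0 : B₀ ≠ 0 := (mul_pos hU (by linarith)).ne'
  have e0 : GeomDecay fun n => b 0 n - B₀ := by
    convert h0.comp_succ.add (h0.const_mul (-t)) using 2 with n
    rw [show b 0 n = _ from (hH.scaled_sum_legalLists t μ n).1, hB₀]
    ring
  have e1 : GeomDecay fun n => b 1 n - B₁ := by
    convert (h1.comp_succ.add (h1.const_mul (-t))).add (h0.const_mul (t * μ)) using 2 with n
    rw [show b 1 n = _ from (hH.scaled_sum_legalLists t μ n).2.1, hB₁]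
    ring
  have e2 : GeomDecay fun n => b 2 n - α * (1 - t) * n - B₂ := by
    convert ((h2.comp_succ.add (h2.const_mul (-t))).add (h1.const_mul (2 * t * μ))).add
      (h0.const_mul (-(t * μ ^ 2))) using 2 with n
    rw [show b 2 n = _ from (hH.scaled_sum_legalLists t μ n).2.2, hB₂]
    push_cast
    ring
  have l0 : Filter.Tendsto (b 0) Filter.atTop (𝓝 B₀) := by
    simpa using e0.tendsto.add_const B₀
  have l1 : Filter.Tendsto (b 1) Filter.atTop (𝓝 B₁) := by
    simpa using e1.tendsto.add_const B₁
  -- `b 2 n - C * n * b 0 n` converges, because `n * (b 0 n - B₀)` tends to `0`.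
  have l2 : Filter.Tendsto (fun n : ℕ => b 2 n - α / U * n * b 0 n) Filter.atTop (𝓝 B₂) := by
    have h3 := (e2.tendsto.sub (e0.tendsto_nat_mul.const_mul (α / U))).add_const B₂
    rw [mul_zero, sub_zero, zero_add] at h3
    refine h3.congr fun n => ?_
    rw [hB₀]
    field_simp
    ring
  have hlim := (l2.div l0 hB₀0).sub ((l1.div l0 hB₀0).pow 2)
  refine ⟨α / U, B₂ / B₀ - (B₁ / B₀) ^ 2 - α / U, by positivity, ?_⟩
  rw [← Filter.tendsto_add_atTop_iff_nat 1]
  have hlim' := hlim.sub_const (B₂ / B₀ - (B₁ / B₀) ^ 2)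
  rw [sub_self] at hlim'
  refine hlim'.congr' ?_
  filter_upwards [Filter.eventually_ge_atTop L, l0.eventually_ne hB₀0] with n hn hne
  rw [hH.varSummands_eq_moments hS hn ht0.ne' μ]
  change (b 2 n - α / U * n * b 0 n) / b 0 n - (b 1 n / b 0 n) ^ 2 - _ =
    b 2 n / b 0 n - (b 1 n / b 0 n) ^ 2 - _
  rw [sub_div, mul_div_cancel_right₀ _ hne]
  push_cast
  ring

end IsPLRS

/-- A function that is positive beyond `L` and asymptotic to an affine function of slope `C > 0`
is bounded below by a linear function of positive slope at most `C`. -/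
theorem exists_linear_lower_bound {f : ℕ → ℝ} {L : ℕ} {C d : ℝ} (hC : 0 < C)
    (hpos : ∀ n, L < n → 0 < f n)
    (hf : Filter.Tendsto (fun n : ℕ => f n - (C * (n : ℝ) + d)) Filter.atTop (𝓝 0)) :
    ∃ κ, 0 < κ ∧ κ ≤ C ∧ ∀ n : ℕ, L < n → κ * n ≤ f n := by
  have h1 : ∀ᶠ n : ℕ in Filter.atTop, C / 2 * n ≤ f n := by
    have h2 := (tendsto_natCast_atTop_atTop (R := ℝ)).const_mul_atTop (half_pos hC)
    filter_upwards [hf.eventually (lt_mem_nhds (show (-1 : ℝ) < 0 by norm_num)),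
      h2.eventually_ge_atTop (1 - d)] with n h3 h4
    linarith
  obtain ⟨N, hN⟩ := Filter.eventually_atTop.1 h1
  have hfin : ∀ M : ℕ, ∃ κ, 0 < κ ∧ ∀ n : ℕ, L < n → n < M → κ * n ≤ f n := by
    intro M
    induction M with
    | zero => exact ⟨1, one_pos, fun n _ hn => absurd hn (Nat.not_lt_zero n)⟩
    | succ M ih =>
      obtain ⟨κ, hκ, h⟩ := ih
      rcases Nat.lt_or_ge L M with hM | hM
      · have hM0 : (0 : ℝ) < M := by exact_mod_cast (Nat.zero_le L).trans_lt hM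
        refine ⟨min κ (f M / M), lt_min hκ (div_pos (hpos M hM) hM0), fun n hn hnM => ?_⟩
        rcases (Nat.lt_succ_iff_lt_or_eq.1 hnM) with h' | rfl
        · exact (mul_le_mul_of_nonneg_right (min_le_left _ _) n.cast_nonneg).trans (h n hn h')
        · exact (le_div_iff₀ hM0).1 (min_le_right _ _)
      · exact ⟨κ, hκ, fun n hn hnM => absurd hn (by omega)⟩
  obtain ⟨κ, hκ, h⟩ := hfin N
  refine ⟨min κ (C / 2), lt_min hκ (half_pos hC), (min_le_right _ _).trans (by linarith),
    fun n hn => ?_⟩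
  rcases Nat.lt_or_ge n N with h' | h'
  · exact (mul_le_mul_of_nonneg_right (min_le_left _ _) n.cast_nonneg).trans (h n hn h')
  · exact (mul_le_mul_of_nonneg_right (min_le_right _ _) n.cast_nonneg).trans (hN n h')

theorem theorem1p4 (H : ℕ → ℕ) (L : ℕ) (c : ℕ → ℕ) (hH : IsPLRS H L c)
    (hS : 2 ≤ plrsSize L c) :
    ∃ κ : ℝ, 0 < κ ∧
      (∀ n : ℕ, L < n → κ * (n : ℝ) ≤ varSummands H L c n) ∧
      ∃ C d : ℝ, κ ≤ C ∧
        Filter.Tendsto (fun n : ℕ => varSummands H L c n - (C * (n : ℝ) + d))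
          Filter.atTop (𝓝 0) := by
  obtain ⟨C, d, hC, hlim⟩ := hH.varSummands_asymptotics hS
  obtain ⟨κ, hκ, hκC, hle⟩ :=
    exists_linear_lower_bound hC (fun n hn => hH.varSummands_pos hS hn) hlim
  exact ⟨κ, hκ, hle, C, d, hκC, hlim⟩
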